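/- Let $q = 3^m$ with $m \ge 1$, let $n \ge 2$, and let $\mathbb F_q \subset \mathbb F_{q^n}$ be finite fields of orders $q$ and $q^n$. Let $\omega \in \mathbb C$ be a primitive cube root of unity, let $\mathrm{Tr} : \mathbb F_q \to \mathbb F_3$, $\mathrm{Tr}(x) = x + x^3 + \cdots + x^{3^{m-1}}$, be the absolute trace, and let $\mathrm{Tr}_{q^n \to q} : \mathbb F_{q^n} \to \mathbb F_q$, $\mathrm{Tr}_{q^n\to q}(x) = x + x^q + \cdots + x^{q^{n-1}}$, be the relative trace. For $a \in \mathbb F_q^*$ define the Kloosterman sum $$K_n(a) = \sum_{x \in \mathbb F_{q^n}} \omega^{\mathrm{Tr}\left(\mathrm{Tr}_{q^n \to q}\left(x + a/x\right)\right)},$$ where $a/x$ is read as $0$ for $x = 0$. Then $K_n(a) \neq 0$ for every $a \in \mathbb F_q^*$. -/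

import Mathlib

namespace TernaryKloosterman

/-- The additive character `e(x) = ω ^ Tr(x)` of a finite field `F` of characteristic `3`, where
`Tr(x) = x + x^3 + x^9 + ⋯` is the absolute trace from `F` to `ZMod 3`, and `ω` is meant to be a
primitive cube root of unity. The residue class `Tr(x)` is represented by `0`, `1` or `2`. -/
noncomputable def e (F : Type*) [Field F] [Algebra (ZMod 3) F] (ω : ℂ) (x : F) : ℂ :=
  ω ^ (Algebra.trace (ZMod 3) F x).val

/-- The additive character `e_n(y) = ω ^ Tr(Tr_{L → F}(y))` of an extension `L` of `F`, where
`Tr_{L → F}(y) = y + y^q + ⋯ + y^(q^(n-1))` is the relative trace (`q = |F|`, `n = [L : F]`). -/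
noncomputable def eExt (F L : Type*) [Field F] [Algebra (ZMod 3) F] [Field L] [Algebra F L]
    (ω : ℂ) (y : L) : ℂ :=
  e F ω (Algebra.trace F L y)

/-- The Kloosterman sum `K_n(a) = ∑_{x ∈ L} e_n(x + a / x)` over the extension `L` of `F`, for
`a ∈ F`. The sum includes `x = 0`, with the convention `a / 0 = 0`. -/
noncomputable def kloostermanExt (F L : Type*) [Field F] [Algebra (ZMod 3) F] [Field L]
    [Fintype L] [Algebra F L] (ω : ℂ) (a : F) : ℂ :=
  ∑ x : L, eExt F L ω (x + algebraMap F L a / x)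

end TernaryKloosterman

/-!
The argument goes through the elliptic curve `E : y ^ 2 = x ^ 3 + x ^ 2 - a`, which is defined over
`F`, and avoids `L`-functions and the Hasse bound.

The number of points of `E` over `L` is `|L| + K_n(a)` (`card_ternaryCurve_point_eq`). To see this,
write `η` for the quadratic character and `ψ` for the additive character of `L`. On the one hand,
counting solutions of `x + a / x = s` gives `K_n(a) = 1 + ∑ ψ(s) η(s² - a)`. On the other hand, the
equation `y³ - y = s` has `1 + ψ(s) + ψ(-s)` solutions, which relates this sum to
`∑ η((y³ - y)² - a)`; here `(y³ - y)²` is a cubic in `u = y²`, and the sum splits into two sums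
over `u`, each of which reduces to `∑ η(v³ + v² - a)`.

Suppose now that `K_n(a) = 0`, so that `E(L)` is a `3`-group of order `q ^ n`, where `q = |F|`. The
`3`-torsion of `E` consists of the origin and the points `(c, ± c)` with `c³ = a`; so `E(L)` is
cyclic, and the `q`-power Frobenius fixes the `3`-torsion. The Frobenius acts on the cyclic group
`E(L)` as multiplication by an integer `u ≡ 1 mod 3` with `uⁿ ≡ 1 mod qⁿ`, and lifting the exponent
shows that `q ^ n` divides `n * |E(F)|` (`card_dvd_mul_card_fixed`). But `E(F)`, the group of fixed
points, has at most `2 * q + 1` elements and its order is a power of `3`; hence `|E(F)| ≤ q` and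
`q ^ (n - 1) ≤ n`, which is impossible for `n ≥ 2`.
-/

namespace TernaryKloosterman

/-! ### Automorphisms of abelian `p`-groups with small `p`-torsion -/

section GroupTheory

variable {A : Type*} [AddCommGroup A]

theorem card_torsion_pow_le [Finite A] {p : ℕ}
    (htor : Nat.card {x : A // p • x = 0} ≤ p) (k : ℕ) :
    Nat.card {x : A // p ^ k • x = 0} ≤ p ^ k := by
  classical
  have := Fintype.ofFinite A
  simp only [Nat.card_eq_fintype_card, Fintype.card_subtype] at htor ⊢
  induction k with
  | zero =>
    simp only [pow_zero, one_smul]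
    rw [Finset.filter_eq' Finset.univ (0 : A)]
    simp
  | succ k ih =>
    have key := Finset.card_le_mul_card_image_of_maps_to
      (s := {x : A | p ^ (k + 1) • x = 0}) (t := {x : A | p ^ k • x = 0})
      (f := fun x => p • x) (fun x hx => by
        simp only [Finset.mem_filter, Finset.mem_univ, true_and] at hx ⊢
        rwa [← mul_smul, ← pow_succ]) p (fun b _ => by
        rcases Finset.eq_empty_or_nonempty
          ({x ∈ ({x : A | p ^ (k + 1) • x = 0} : Finset A) | p • x = b}) with h | ⟨x₀, hx₀⟩
        · rw [h]; simp
        · refine le_trans (Finset.card_le_card_of_injOn (fun x => x - x₀) (fun x hx => ?_)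
            (sub_left_injective.injOn)) htor
          simp only [Finset.coe_filter, Finset.mem_filter, Finset.mem_univ, true_and,
            Set.mem_ofPred_eq] at hx hx₀ ⊢
          rw [smul_sub, hx.2, hx₀.2, sub_self])
    calc _ ≤ _ := key
      _ ≤ p * p ^ k := Nat.mul_le_mul_left _ ih
      _ = p ^ (k + 1) := by ring

/-- A finite abelian `p`-group with at most `p` elements killed by `p` is cyclic: its exponent
`p ^ k` bounds its order, since it has at most `p ^ k` elements killed by `p ^ k`. -/
theorem isAddCyclic_of_card_torsion_le [Finite A] {p M : ℕ} (hp : p.Prime)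
    (hA : Nat.card A = p ^ M) (htor : Nat.card {x : A // p • x = 0} ≤ p) : IsAddCyclic A := by
  rw [IsAddCyclic.iff_exponent_eq_card]
  obtain ⟨k, -, hk⟩ := (Nat.dvd_prime_pow hp).1 (hA ▸ AddGroup.exponent_dvd_nat_card (G := A))
  refine le_antisymm (Nat.le_of_dvd Nat.card_pos AddGroup.exponent_dvd_nat_card) ?_
  have h : ∀ x : A, p ^ k • x = 0 := fun x => hk ▸ AddMonoid.exponent_nsmul_eq_zero x
  calc Nat.card A = Nat.card {x : A // p ^ k • x = 0} :=
        (Nat.card_congr (Equiv.subtypeUnivEquiv h)).symm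
    _ ≤ p ^ k := card_torsion_pow_le htor k
    _ = _ := hk.symm

/-- Let `A` be an abelian group of order `p ^ M`, for an odd prime `p`, with at most `p` elements
killed by `p`. If an endomorphism `φ` with `φ ^ n = 1` is trivial on the `p`-torsion, then
`p ^ M` divides `n` times the number of fixed points. Indeed `A` is cyclic and `φ` is
multiplication by some `u ≡ 1 [ZMOD p]`, so that lifting the exponent turns `p ^ M ∣ u ^ n - 1` into
`p ^ M ∣ n * (u - 1)`. -/
theorem card_dvd_mul_card_fixed [Finite A] {p M n : ℕ} (hp : p.Prime) (hodd : Odd p)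
    (hA : Nat.card A = p ^ M) (htor : Nat.card {x : A // p • x = 0} ≤ p)
    (φ : A →+ A) (hfix : ∀ x, p • x = 0 → φ x = x) (hφ : ∀ x, φ^[n] x = x) :
    p ^ M ∣ n * Nat.card {x : A // φ x = x} := by
  obtain rfl | hM := Nat.eq_zero_or_pos M
  · simp
  have := isAddCyclic_of_card_torsion_le hp hA htor
  obtain ⟨g, hg⟩ := IsAddCyclic.exists_generator (α := A)
  have hog : addOrderOf g = p ^ M := by
    rw [← hA]; exact addOrderOf_eq_card_of_forall_mem_zmultiples hg
  obtain ⟨u, hu⟩ := AddSubgroup.mem_zmultiples_iff.1 (hg (φ g))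
  have hφu : ∀ x, φ x = u • x := fun x => by
    obtain ⟨j, rfl⟩ := AddSubgroup.mem_zmultiples_iff.1 (hg x)
    rw [map_zsmul, ← hu, smul_comm]
  have hiter : ∀ k x, φ^[k] x = u ^ k • x := fun k => by
    induction k with
    | zero => simp
    | succ k ih =>
      intro x
      rw [Function.iterate_succ_apply', ih, hφu, ← mul_smul, pow_succ']
  have hun : ((p ^ M : ℕ) : ℤ) ∣ u ^ n - 1 := by
    rw [← hog, addOrderOf_dvd_iff_zsmul_eq_zero, sub_smul, ← hiter, hφ, one_smul, sub_self]
  -- `p ^ (M - 1) • g` lies in the `p`-torsion, hence is fixed by `φ`.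
  have hu1 : (p : ℤ) ∣ u - 1 := by
    have h1 : φ (p ^ (M - 1) • g) = p ^ (M - 1) • g := by
      apply hfix
      rw [← mul_smul, mul_comm, pow_sub_one_mul hM.ne', ← hog, addOrderOf_nsmul_eq_zero]
    have h2 : ((p ^ M : ℕ) : ℤ) ∣ (p ^ (M - 1) : ℕ) * (u - 1) := by
      rw [← hog, addOrderOf_dvd_iff_zsmul_eq_zero, mul_comm, mul_smul, natCast_zsmul, sub_smul,
        ← hφu, h1, one_smul, sub_self]
    rw [← pow_sub_one_mul hM.ne'] at h2
    push_cast at h2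
    exact (mul_dvd_mul_iff_left (pow_ne_zero _ (by exact_mod_cast hp.ne_zero))).1 h2
  have hpu : ¬ (p : ℤ) ∣ u := fun h => by
    have : (p : ℤ) ∣ 1 := by simpa using dvd_sub h hu1
    exact hp.one_lt.ne' (by exact_mod_cast Int.eq_one_of_dvd_one (by positivity) this)
  have hlte : ((p ^ M : ℕ) : ℤ) ∣ n * (u - 1) := by
    push_cast at hun ⊢
    rw [pow_dvd_iff_le_emultiplicity] at hun ⊢
    have := Int.emultiplicity_pow_sub_pow hp hodd (y := 1) hu1 hpu n
    rw [one_pow] at this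
    rwa [emultiplicity_mul (Nat.prime_iff_prime_int.1 hp), Int.natCast_emultiplicity, add_comm,
      ← this]
  have hcard : Nat.card {x : A // φ x = x} = (p ^ M).gcd (u - 1).natAbs := by
    rw [← hA, ← IsAddCyclic.card_nsmulAddMonoidHom_ker]
    refine Nat.card_congr (Equiv.subtypeEquivRight fun x => ?_)
    rw [AddMonoidHom.mem_ker, nsmulAddMonoidHom_apply, natAbs_nsmul_eq_zero, hφu, sub_smul,
      one_smul, sub_eq_zero]
  rw [hcard, ← Nat.gcd_mul_left]
  refine Nat.dvd_gcd (Dvd.intro_left _ rfl) ?_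
  have := Int.natCast_dvd.1 hlte
  rwa [Int.natAbs_mul, Int.natAbs_natCast] at this

end GroupTheory

/-! ### Kloosterman sums as sums of the quadratic character -/

section CharacterSums

theorem sum_comp_eq_sum_card_mul {ι κ R : Type*} [Fintype ι] [Fintype κ] [DecidableEq κ]
    [CommRing R] (s : Finset ι) (f : ι → κ) (g : κ → R) :
    ∑ x ∈ s, g (f x) = ∑ k, ((s.filter (fun x => f x = k)).card : R) * g k := by
  rw [← Finset.sum_fiberwise s f]
  refine Finset.sum_congr rfl fun k _ => ?_
  rw [Finset.sum_congr rfl (fun x hx => by rw [(Finset.mem_filter.1 hx).2]), Finset.sum_const,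
    nsmul_eq_mul]

theorem quadraticChar_cube {L : Type*} [Field L] [Fintype L] [DecidableEq L] (z : L) :
    quadraticChar L (z ^ 3) = quadraticChar L z := by
  rcases eq_or_ne z 0 with rfl | hz
  · simp
  · rw [map_pow, pow_succ, quadraticChar_sq_one hz, one_mul]

theorem quadraticChar_sq_mul {L : Type*} [Field L] [Fintype L] [DecidableEq L] {c : L}
    (hc : c ≠ 0) (z : L) :
    quadraticChar L (c ^ 2 * z) = quadraticChar L z := by
  rw [map_mul, quadraticChar_sq_one' hc, one_mul]

variable {L : Type*} [Field L] [Fintype L] [DecidableEq L] [CharP L 3]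

theorem ringChar_ne_two_of_charP_three (L : Type*) [Field L] [CharP L 3] : ringChar L ≠ 2 := by
  rw [ringChar.eq L 3]; norm_num

theorem three_eq_zero (L : Type*) [Field L] [CharP L 3] : (3 : L) = 0 := by
  exact_mod_cast CharP.cast_eq_zero L 3

theorem card_filter_sq_eq (u : L) :
    ((Finset.univ.filter (fun x : L => x ^ 2 = u)).card : ℤ) = 1 + quadraticChar L u := by
  rw [add_comm, ← quadraticChar_card_sqrts (ringChar_ne_two_of_charP_three L) u]
  congr 2
  ext; simp

theorem sum_comp_sq (g : L → ℂ) :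
    ∑ y, g (y ^ 2) = ∑ u, (1 + (quadraticChar L u : ℂ)) * g u := by
  rw [sum_comp_eq_sum_card_mul]
  refine Finset.sum_congr rfl fun u _ => ?_
  rw [← Int.cast_natCast (R := ℂ), card_filter_sq_eq]
  push_cast; rfl

/-- For `a ≠ 0`, the equation `x + a / x = s` is `x ^ 2 - s * x + a = 0`, whose discriminant is
`s ^ 2 - 4 * a = s ^ 2 - a` in characteristic `3`. -/
theorem sum_comp_add_div {a : L} (ha : a ≠ 0) (g : L → ℂ) :
    ∑ x ∈ Finset.univ.erase 0, g (x + a / x) =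
      ∑ s, (1 + (quadraticChar L (s ^ 2 - a) : ℂ)) * g s := by
  have h3 := three_eq_zero L
  rw [sum_comp_eq_sum_card_mul]
  refine Finset.sum_congr rfl fun s _ => ?_
  have key : ((Finset.univ.erase 0).filter (fun x : L => x + a / x = s)).card =
      (Finset.univ.filter (fun z : L => z ^ 2 = s ^ 2 - a)).card := by
    -- Completing the square, up to sign: `2 * x - s = -(x + s)` in characteristic `3`.
    refine Finset.card_bij' (fun x _ => x + s) (fun z _ => z - s) ?_ ?_ ?_ ?_
    · intro x hx
      simp only [Finset.mem_filter, Finset.mem_erase, Finset.mem_univ, and_true, true_and] at hx ⊢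
      obtain ⟨hx0, rfl⟩ := hx
      field_simp
      linear_combination (x ^ 4 + a * x ^ 2) * h3
    · intro z hz
      simp only [Finset.mem_filter, Finset.mem_erase, Finset.mem_univ, and_true, true_and] at hz ⊢
      have h0 : z - s ≠ 0 := fun h => ha (by
        rw [sub_eq_zero.1 h] at hz; linear_combination hz)
      refine ⟨h0, ?_⟩
      field_simp
      linear_combination hz + (s^2 - z * s) * h3
    · intro x _; ring
    · intro x _; ring
  rw [key, ← Int.cast_natCast (R := ℂ), card_filter_sq_eq]
  push_cast; rfl

theorem sum_quadraticChar_sq_sub {a : L} (ha : a ≠ 0) :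
    ∑ s : L, (quadraticChar L (s ^ 2 - a) : ℂ) = -1 := by
  have h := sum_comp_add_div ha (fun _ => 1)
  simp only [mul_one, Finset.sum_add_distrib, Finset.sum_const, nsmul_eq_mul,
    Finset.card_erase_of_mem (Finset.mem_univ (0 : L)), Finset.card_univ] at h
  rw [Nat.cast_sub Fintype.card_pos] at h
  push_cast at h
  linear_combination -h

theorem sum_addChar_add_div {ψ : AddChar L ℂ} (hψ : ψ ≠ 1) {a : L} (ha : a ≠ 0) :
    ∑ x, ψ (x + a / x) = 1 + ∑ s, (quadraticChar L (s ^ 2 - a) : ℂ) * ψ s := by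
  rw [← Finset.add_sum_erase _ _ (Finset.mem_univ (0 : L)), sum_comp_add_div ha ψ]
  simp only [add_mul, one_mul, Finset.sum_add_distrib, AddChar.sum_eq_zero_of_ne_one hψ]
  simp

theorem card_filter_cube_sub_self_le (s : L) :
    (Finset.univ.filter (fun y : L => y ^ 3 - y = s)).card ≤ 3 := by
  rcases Finset.eq_empty_or_nonempty
    (Finset.univ.filter (fun y : L => y ^ 3 - y = s)) with h | ⟨y₀, h⟩
  · simp [h]
  -- The solutions of `t ^ 3 = t` in characteristic `3` are `0`, `1` and `-1`.
  refine (Finset.card_le_card (t := {y₀, y₀ + 1, y₀ - 1}) fun y hy => ?_).trans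
    Finset.card_le_three
  simp only [Finset.mem_filter, Finset.mem_univ, true_and] at h hy
  simp only [Finset.mem_insert, Finset.mem_singleton]
  have : (y - y₀) * ((y - (y₀ + 1)) * (y - (y₀ - 1))) = 0 := by
    linear_combination hy - h - (y * y₀ * (y - y₀)) * three_eq_zero L
  simpa [sub_eq_zero] using this

/-- Additive Hilbert 90 as a count: the equation `y ^ 3 - y = s` has three solutions if `ψ s = 1`
and none otherwise, where `ψ` is a nontrivial Frobenius-invariant additive character. -/
theorem natCast_card_filter_cube_sub_self {ψ : AddChar L ℂ} (hψ : ψ ≠ 1)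
    (hfrob : ∀ y, ψ (y ^ 3) = ψ y) (s : L) :
    ((Finset.univ.filter (fun y : L => y ^ 3 - y = s)).card : ℂ) = 1 + ψ s + ψ (-s) := by
  have hcube : ∀ s, ψ s ^ 3 = 1 := fun s => by
    rw [← AddChar.map_nsmul_eq_pow, nsmul_eq_mul, Nat.cast_ofNat, three_eq_zero L, zero_mul,
      AddChar.map_zero_eq_one]
  have hneg : ∀ s, ψ (-s) = ψ s ^ 2 := fun s => by
    rw [← AddChar.map_nsmul_eq_pow, nsmul_eq_mul]
    congr 1
    push_cast
    linear_combination (-s) * three_eq_zero L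
  have hterm : ∀ s, ((if ψ s = 1 then 3 else 0 : ℕ) : ℂ) = 1 + ψ s + ψ (-s) := fun s => by
    split_ifs with h
    · rw [hneg, h]; norm_num
    · have : (ψ s - 1) * (1 + ψ s + ψ s ^ 2) = 0 := by linear_combination hcube s
      rw [hneg, (mul_eq_zero.1 this).resolve_left (sub_ne_zero.2 h), Nat.cast_zero]
  -- The termwise bound by `3` or `0` is an equality because both sides have the same sum `|L|`.
  have hle : ∀ s ∈ Finset.univ, (Finset.univ.filter (fun y : L => y ^ 3 - y = s)).card ≤
      if ψ s = 1 then 3 else 0 := fun s _ => by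
    split_ifs with h
    · exact card_filter_cube_sub_self_le s
    · rw [Nat.le_zero, Finset.card_eq_zero, Finset.filter_eq_empty_iff]
      rintro y - rfl
      apply h
      have h1 : ψ (y ^ 3 - y) * ψ y = ψ y := by
        rw [← AddChar.map_add_eq_mul, sub_add_cancel, hfrob]
      exact mul_right_cancel₀ (b := ψ y) (fun h0 => by simpa [h0] using hcube y)
        (by rw [h1, one_mul])
  have hsum : ∑ s : L, (Finset.univ.filter (fun y : L => y ^ 3 - y = s)).card =
      ∑ s : L, if ψ s = 1 then 3 else 0 := by
    have h1 : ∑ s : L, (Finset.univ.filter (fun y : L => y ^ 3 - y = s)).card = Fintype.card L :=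
      (Finset.card_eq_sum_card_fiberwise (fun y _ => Finset.mem_univ (y ^ 3 - y))).symm
    rw [h1, ← Nat.cast_inj (R := ℂ), Nat.cast_sum]
    simp only [hterm, Finset.sum_add_distrib]
    rw [show ∑ s, ψ (-s) = ∑ s, ψ s from _root_.Equiv.sum_comp (Equiv.neg L) ψ,
      AddChar.sum_eq_zero_of_ne_one hψ]
    simp
  rw [(Finset.sum_eq_sum_iff_of_le hle).1 hsum s (Finset.mem_univ s), hterm]

theorem sum_comp_cube_sub_self {ψ : AddChar L ℂ} (hψ : ψ ≠ 1) (hfrob : ∀ y, ψ (y ^ 3) = ψ y)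
    (g : L → ℂ) : ∑ y, g (y ^ 3 - y) = ∑ s, (1 + ψ s + ψ (-s)) * g s := by
  rw [sum_comp_eq_sum_card_mul]
  exact Finset.sum_congr rfl fun s _ => by rw [natCast_card_filter_cube_sub_self hψ hfrob]

theorem sum_quadraticChar_shift (a : L) :
    ∑ u : L, (quadraticChar L (u ^ 3 + u ^ 2 + u - a) : ℂ) =
      ∑ v : L, (quadraticChar L (v ^ 3 + v ^ 2 - a) : ℂ) := by
  rw [← _root_.Equiv.sum_comp (Equiv.addRight (1 : L))]
  refine Finset.sum_congr rfl fun v _ => ?_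
  rw [Equiv.coe_addRight]
  congr 2
  linear_combination (v ^ 2 + 2 * v + 1) * three_eq_zero L

/-- The substitutions `u = -a / w` and `w = v ^ 3 - a` turn the twisted sum into the sum for
`v ^ 3 + v ^ 2 - a`. The second one uses that cubing is bijective, and that
`w ^ 3 + w ^ 2 - a * w + a ^ 2` becomes the cube of `v ^ 3 + v ^ 2 - a`; the curves
`y ^ 2 = v ^ 3 + v ^ 2 - a` and `y ^ 2 = w ^ 3 + w ^ 2 - a * w + a ^ 2` are `3`-isogenous. -/
theorem sum_quadraticChar_twist {a : L} (ha : a ≠ 0) :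
    ∑ u : L, (quadraticChar L u : ℂ) * (quadraticChar L (u ^ 3 + u ^ 2 + u - a) : ℂ) =
      ∑ v : L, (quadraticChar L (v ^ 3 + v ^ 2 - a) : ℂ) - 1 := by
  have h3 := three_eq_zero L
  have h1 : ∑ u : L, (quadraticChar L u : ℂ) * (quadraticChar L (u ^ 3 + u ^ 2 + u - a) : ℂ) =
      ∑ w ∈ Finset.univ.erase (0 : L), (quadraticChar L (w ^ 3 + w ^ 2 - a * w + a ^ 2) : ℂ) := by
    rw [← Finset.add_sum_erase _ _ (Finset.mem_univ (0 : L))]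
    simp only [MulChar.map_zero, Int.cast_zero, zero_mul, zero_add]
    refine Finset.sum_bij' (fun u _ => -a / u) (fun w _ => -a / w) ?_ ?_ ?_ ?_ ?_
    · intro u hu; simpa [ha] using hu
    · intro u hu; simpa [ha] using hu
    · intro u hu
      have : u ≠ 0 := by simpa using hu
      field_simp
    · intro u hu
      have : u ≠ 0 := by simpa using hu
      field_simp
    · intro u hu
      have hu0 : u ≠ 0 := by simpa using hu
      rw [← Int.cast_mul, ← map_mul, ← quadraticChar_sq_mul (div_ne_zero ha (pow_ne_zero 2 hu0))]
      congr 2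
      field_simp
      ring
  have h2 : ∑ w : L, (quadraticChar L (w ^ 3 + w ^ 2 - a * w + a ^ 2) : ℂ) =
      ∑ v : L, (quadraticChar L (v ^ 3 + v ^ 2 - a) : ℂ) := by
    have hbij : Function.Bijective (fun v : L => v ^ 3 - a) :=
      (Equiv.subRight a).bijective.comp
        (Finite.injective_iff_bijective.1 (frobenius_inj L 3))
    rw [← Fintype.sum_bijective _ hbij _ _ (fun _ => rfl)]
    refine Finset.sum_congr rfl fun v _ => ?_
    rw [← quadraticChar_cube (v ^ 3 + v ^ 2 - a)]
    congr 2
    linear_combination ((-v ^ 6 * a + v ^ 3 * a ^ 2 - v ^ 3 * a + a ^ 2) -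
      (v ^ 3 + v ^ 2) * (v ^ 2 - a) * (v ^ 3 - a)) * h3
  -- The term at `w = 0`, absent from `h1`, is `1`.
  rw [h1, ← h2, ← Finset.add_sum_erase _ _ (Finset.mem_univ (0 : L))]
  have : quadraticChar L (a ^ 2) = 1 := quadraticChar_sq_one' ha
  simp [this]

/-- The Kloosterman sum of a Frobenius-invariant character is one more than the sum of the quadratic
character over the values of `v ^ 3 + v ^ 2 - a`. Both arise on evaluating the sum of the quadratic
character over the values of `(y ^ 3 - y) ^ 2 - a`, once through `s = y ^ 3 - y` and once through
`u = y ^ 2`. -/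
theorem sum_addChar_add_div_eq_sum_quadraticChar {ψ : AddChar L ℂ} (hψ : ψ ≠ 1)
    (hfrob : ∀ y, ψ (y ^ 3) = ψ y) {a : L} (ha : a ≠ 0) :
    ∑ x, ψ (x + a / x) = 1 + ∑ v : L, (quadraticChar L (v ^ 3 + v ^ 2 - a) : ℂ) := by
  rw [sum_addChar_add_div hψ ha]
  have h1 := sum_comp_cube_sub_self hψ hfrob (fun s => (quadraticChar L (s ^ 2 - a) : ℂ))
  have h2 := sum_comp_sq (fun u : L => (quadraticChar L (u ^ 3 + u ^ 2 + u - a) : ℂ))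
  have h3 : ∀ y : L, (y ^ 3 - y) ^ 2 - a = (y ^ 2) ^ 3 + (y ^ 2) ^ 2 + y ^ 2 - a := fun y => by
    linear_combination (-y ^ 4) * three_eq_zero L
  have h4 : ∑ s, ψ (-s) * (quadraticChar L (s ^ 2 - a) : ℂ) =
      ∑ s, (quadraticChar L (s ^ 2 - a) : ℂ) * ψ s := by
    rw [← _root_.Equiv.sum_comp (Equiv.neg L)]
    exact Finset.sum_congr rfl fun s _ => by simp [mul_comm]
  simp only [h3] at h1
  rw [h2] at h1
  simp only [add_mul, one_mul, Finset.sum_add_distrib, sum_quadraticChar_shift,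
    sum_quadraticChar_twist ha, sum_quadraticChar_sq_sub ha, h4] at h1
  simp only [mul_comm (ψ _)] at h1
  linear_combination -h1 / 2

end CharacterSums

/-! ### The elliptic curve `y ^ 2 = x ^ 3 + x ^ 2 - a` in characteristic `3` -/

section Curve

open WeierstrassCurve

/-- The Weierstrass curve `y ^ 2 = x ^ 3 + x ^ 2 - a`. In characteristic `3` its discriminant is
`a`, so that it is elliptic for `a ≠ 0`. -/
def ternaryCurve {K : Type*} [Field K] (a : K) : WeierstrassCurve.Affine K :=
  { a₁ := 0, a₂ := 1, a₃ := 0, a₄ := 0, a₆ := -a }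

variable {K : Type*} [Field K]

theorem ternaryCurve_baseChange {F L : Type*} [Field F] [Field L] [Algebra F L] (a : F) :
    (ternaryCurve a).baseChange L = ternaryCurve (algebraMap F L a) := by
  ext <;> simp [ternaryCurve, WeierstrassCurve.baseChange]

theorem ternaryCurve_equation_iff (a x y : K) :
    (ternaryCurve a).Equation x y ↔ y ^ 2 = x ^ 3 + x ^ 2 - a := by
  rw [Affine.equation_iff]
  simp [ternaryCurve, sub_eq_add_neg]

theorem ternaryCurve_nonsingular_iff [CharP K 3] {a : K} (ha : a ≠ 0) (x y : K) :
    (ternaryCurve a).Nonsingular x y ↔ y ^ 2 = x ^ 3 + x ^ 2 - a := by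
  have hΔ : (ternaryCurve a).Δ = a := by
    simp only [ternaryCurve, WeierstrassCurve.Δ, WeierstrassCurve.b₂, WeierstrassCurve.b₄,
      WeierstrassCurve.b₆, WeierstrassCurve.b₈]
    linear_combination (21 * a - 144 * a ^ 2) * three_eq_zero K
  rw [← Affine.equation_iff_nonsingular_of_Δ_ne_zero (by rwa [hΔ]), ternaryCurve_equation_iff]

instance finite_affine_point [Finite K] (W : WeierstrassCurve.Affine K) : Finite W.Point :=
  have : Finite (WithZero {p : K × K // W.Nonsingular p.1 p.2}) :=
    inferInstanceAs (Finite (Option _))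
  Finite.of_equiv _ (Affine.nonsingularPointEquiv W).symm

theorem card_ternaryCurve_point [Fintype K] [DecidableEq K] [CharP K 3] {a : K} (ha : a ≠ 0) :
    (Nat.card (ternaryCurve a).Point : ℤ) =
      1 + Fintype.card K + ∑ x : K, quadraticChar K (x ^ 3 + x ^ 2 - a) := by
  have e1 : (ternaryCurve a).Point ≃
      Option ((x : K) × {y : K // y ^ 2 = x ^ 3 + x ^ 2 - a}) :=
    (Affine.nonsingularPointEquiv _).trans <| Equiv.optionCongr <|
      (Equiv.subtypeEquivRight fun p : K × K => ternaryCurve_nonsingular_iff ha p.1 p.2).trans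
        (Equiv.subtypeProdEquivSigmaSubtype fun x y : K => y ^ 2 = x ^ 3 + x ^ 2 - a)
  rw [Nat.card_congr e1, Nat.card_eq_fintype_card, Fintype.card_option, Fintype.card_sigma]
  push_cast
  simp only [Fintype.card_subtype, card_filter_sq_eq, Finset.sum_add_distrib]
  simp [Finset.card_univ]
  ring

/-- The trivial bound on the number of points, which suffices in place of the Hasse bound. -/
theorem card_ternaryCurve_point_le [Fintype K] [CharP K 3] {a : K} (ha : a ≠ 0) :
    Nat.card (ternaryCurve a).Point ≤ 2 * Fintype.card K + 1 := by
  classical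
  have h : ∑ x : K, quadraticChar K (x ^ 3 + x ^ 2 - a) ≤ Fintype.card K := by
    calc _ ≤ ∑ x : K, (1 : ℤ) := Finset.sum_le_sum fun x _ => by
          rcases eq_or_ne (x ^ 3 + x ^ 2 - a) 0 with h | h
          · simp [h]
          · rcases quadraticChar_dichotomy h with h | h <;> simp [h]
      _ = _ := by simp
  have := card_ternaryCurve_point ha
  omega

/-- A point `(x, y)` of order `3` satisfies `2 • (x, y) = -(x, y)`. In characteristic `3` the tangent
has slope `x / y`, and comparing first coordinates gives `(x / y) ^ 2 = 1`. -/
theorem three_torsion_ternaryCurve [DecidableEq K] [CharP K 3] {a x y : K}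
    (h : (ternaryCurve a).Nonsingular x y) (h3 : 3 • Affine.Point.some x y h = 0) :
    x ^ 3 = a ∧ (y = x ∨ y = -x) := by
  have hy : y ≠ (ternaryCurve a).negY x y := fun hy => by
    have h2 := Affine.Point.add_self_of_Y_eq (h₁ := h) hy
    rw [succ_nsmul, two_nsmul, h2, zero_add] at h3
    exact Affine.Point.some_ne_zero h h3
  have h2 : Affine.Point.some x y h + Affine.Point.some x y h = -Affine.Point.some x y h := by
    rw [succ_nsmul, two_nsmul] at h3
    exact eq_neg_of_add_eq_zero_left h3
  rw [Affine.Point.add_self_of_Y_ne hy, Affine.Point.neg_some, Affine.Point.some.injEq,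
    Affine.slope_of_Y_ne rfl hy] at h2
  have hx := h2.1
  have h0 := three_eq_zero K
  simp only [ternaryCurve, Affine.addX, Affine.negY] at hx hy
  have hy0 : y ≠ 0 := fun h => hy (by simp [h])
  have h2 : (2 : K) ≠ 0 := fun h => one_ne_zero (α := K) (by linear_combination h0 - h)
  have hyy : y - (-y - 0 * x - 0) = 2 * y := by ring
  rw [hyy] at hx
  field_simp at hx
  have heq := (ternaryCurve_equation_iff a x y).1 h.1
  have hsq : y ^ 2 = x ^ 2 := by
    linear_combination -hx + (3 * x ^ 4 + 4 * x ^ 3 + x ^ 2 - y ^ 2 - 4 * x * y ^ 2) * h0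
  exact ⟨by linear_combination hsq - heq, sq_eq_sq_iff_eq_or_eq_neg.1 hsq⟩

theorem card_three_torsion_ternaryCurve_le [Finite K] [DecidableEq K] [CharP K 3] (a : K) :
    Nat.card {P : (ternaryCurve a).Point // 3 • P = 0} ≤ 3 := by
  have hinj : Function.Injective (fun x : K => x ^ 3) := frobenius_inj K 3
  obtain ⟨c, hc⟩ := Finite.injective_iff_surjective.1 hinj a
  let f : {P : (ternaryCurve a).Point // 3 • P = 0} →
      ({none, some c, some (-c)} : Finset (Option K)) :=
    fun P => match P with
    | ⟨.zero, _⟩ => ⟨none, by simp⟩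
    | ⟨.some x y h, hP⟩ => ⟨some y, by
        obtain ⟨h1, h2⟩ := three_torsion_ternaryCurve h hP
        obtain rfl : x = c := hinj (h1.trans hc.symm)
        rcases h2 with rfl | rfl <;> simp⟩
  have hf : Function.Injective f := by
    rintro ⟨_ | ⟨x, y, h⟩, hP⟩ ⟨_ | ⟨x', y', h'⟩, hP'⟩ hPQ
    · rfl
    · simp [f] at hPQ
    · simp [f] at hPQ
    · have h1 : x = x' := hinj ((three_torsion_ternaryCurve h hP).1.trans
        (three_torsion_ternaryCurve h' hP').1.symm)
      have h2 : y = y' := by simpa [f] using hPQ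
      subst h1 h2
      rfl
  refine (Nat.card_le_card_of_injective f hf).trans ?_
  rw [Nat.card_eq_fintype_card, Fintype.card_coe]
  exact Finset.card_le_three

end Curve

/-! ### The action of Frobenius -/

section Frobenius

open WeierstrassCurve

variable {F L : Type*} [Field F] [Fintype F] [Field L] [Algebra F L]

theorem mem_range_algebraMap_of_pow_card_eq {x : L} (hx : x ^ Fintype.card F = x) :
    ∃ y, algebraMap F L y = x := by
  classical
  by_contra! hne
  have hq := Fintype.one_lt_card (α := F)
  have hdeg := FiniteField.X_pow_card_sub_X_natDegree_eq L hq
  have hne0 := FiniteField.X_pow_card_sub_X_ne_zero L hq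
  have := Polynomial.card_le_degree_of_subset_roots (R := L)
    (p := Polynomial.X ^ Fintype.card F - Polynomial.X)
    (Z := insert x (Finset.univ.image (algebraMap F L))) (fun z hz => by
      rw [Polynomial.mem_roots hne0]
      simp only [Finset.mem_val, Finset.mem_insert, Finset.mem_image, Finset.mem_univ, true_and]
        at hz
      rcases hz with rfl | ⟨y, rfl⟩
      · simp [hx]
      · simp [← map_pow, FiniteField.pow_card])
  rw [hdeg, Finset.card_insert_of_notMem (by simpa using hne),
    Finset.card_image_of_injective _ (algebraMap F L).injective, Finset.card_univ] at this
  omega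

/-- The fixed points of the `|F|`-power Frobenius are the points with coordinates in `F`. -/
theorem card_fixed_le [DecidableEq L] [CharP F 3] {a : F} (ha : a ≠ 0) :
    Nat.card {P : ((ternaryCurve a).baseChange L).toAffine.Point //
      Affine.Point.map (FiniteField.frobeniusAlgHom F L) P = P} ≤ 2 * Fintype.card F + 1 := by
  classical
  have key : ∀ P : {P : ((ternaryCurve a).baseChange L).toAffine.Point //
      Affine.Point.map (FiniteField.frobeniusAlgHom F L) P = P},
      ∃ Q, Affine.Point.baseChange (W' := ternaryCurve a) F L Q = P.1 := by
    rintro ⟨_ | ⟨x, y, h⟩, hP⟩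
    · exact ⟨0, rfl⟩
    · rw [Affine.Point.map_some, Affine.Point.some.injEq] at hP
      obtain ⟨x, rfl⟩ := mem_range_algebraMap_of_pow_card_eq hP.1
      obtain ⟨y, rfl⟩ := mem_range_algebraMap_of_pow_card_eq hP.2
      exact ⟨.some x y (((ternaryCurve a).baseChange_nonsingular
        (Algebra.ofId F L).injective x y).1 h), rfl⟩
  choose g hg using key
  have hinj : Function.Injective g := fun P Q h => Subtype.ext (by rw [← hg P, ← hg Q, h])
  have hle := Nat.card_le_card_of_injective g hinj
  refine hle.trans ?_
  rw [ternaryCurve_baseChange]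
  exact card_ternaryCurve_point_le ha

/-- The `3`-torsion points have coordinates `(c, ± c)` with `c ^ 3 = a`, and `c` lies in `F`. -/
theorem frobenius_eq_of_three_torsion [DecidableEq L] [CharP F 3] [CharP L 3] {a : F}
    (P : ((ternaryCurve a).baseChange L).toAffine.Point) (hP : 3 • P = 0) :
    Affine.Point.map (FiniteField.frobeniusAlgHom F L) P = P := by
  obtain ⟨c, hc⟩ := Finite.injective_iff_surjective.1 (frobenius_inj F 3) a
  have hcq : (algebraMap F L c) ^ Fintype.card F = algebraMap F L c := by
    rw [← map_pow, FiniteField.pow_card]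
  have hcq' : (-algebraMap F L c) ^ Fintype.card F = -algebraMap F L c := by
    rw [← map_neg, ← map_pow, FiniteField.pow_card]
  obtain _ | ⟨x, y, h⟩ := P
  · rfl
  have key : x ^ 3 = algebraMap F L a ∧ (y = x ∨ y = -x) := by
    revert h
    rw [ternaryCurve_baseChange]
    exact three_torsion_ternaryCurve
  obtain rfl : x = algebraMap F L c := frobenius_inj L 3 (by
    simp only [frobenius_def] at hc ⊢
    rw [key.1, ← hc, map_pow])
  rw [Affine.Point.map_some, Affine.Point.some.injEq, FiniteField.coe_frobeniusAlgHom]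
  rcases key.2 with rfl | rfl
  · exact ⟨hcq, hcq⟩
  · exact ⟨hcq, hcq'⟩

theorem map_frobenius_iterate [Fintype L] [DecidableEq L] {n : ℕ}
    (hL : Fintype.card L = Fintype.card F ^ n) (W : WeierstrassCurve.Affine F)
    (P : (W.baseChange L).toAffine.Point) :
    (Affine.Point.map (FiniteField.frobeniusAlgHom F L))^[n] P = P := by
  have hiter : ∀ k, (Affine.Point.map (FiniteField.frobeniusAlgHom F L))^[k] P =
      Affine.Point.map (FiniteField.frobeniusAlgHom F L ^ k) P := fun k => by
    induction k with
    | zero => cases P <;> rfl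
    | succ k ih => rw [Function.iterate_succ_apply', ih, Affine.Point.map_map, pow_succ']; rfl
  have hpow : FiniteField.frobeniusAlgHom F L ^ n = 1 := AlgHom.ext fun x => by
    rw [AlgHom.coe_pow, FiniteField.coe_frobeniusAlgHom, pow_iterate, ← hL]
    exact FiniteField.pow_card x
  rw [hiter, hpow]
  cases P <;> rfl

/-- Over an extension `L` of degree `n ≥ 2` of a field `F` of characteristic `3`, the curve
`y ^ 2 = x ^ 3 + x ^ 2 - a` with `a ∈ F` never has exactly `|L|` points. -/
theorem card_ternaryCurve_point_ne [Fintype L] {m n : ℕ} (hn : 2 ≤ n) [CharP F 3] [CharP L 3]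
    (hF : Fintype.card F = 3 ^ m) (hL : Fintype.card L = (3 ^ m) ^ n) {a : F} (ha : a ≠ 0) :
    Nat.card (ternaryCurve (algebraMap F L a)).Point ≠ Fintype.card L := by
  classical
  intro hE
  have hm : m ≠ 0 := fun h => by
    have := Fintype.one_lt_card (α := F)
    simp [hF, h] at this
  have hcard : Nat.card ((ternaryCurve a).baseChange L).toAffine.Point = 3 ^ (m * n) := by
    rw [ternaryCurve_baseChange, pow_mul, ← hL, hE]
  have htor : Nat.card {P : ((ternaryCurve a).baseChange L).toAffine.Point // 3 • P = 0} ≤ 3 := by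
    rw [ternaryCurve_baseChange]
    exact card_three_torsion_ternaryCurve_le _
  let φ := Affine.Point.map (W' := ternaryCurve a) (FiniteField.frobeniusAlgHom F L)
  have hdvd := card_dvd_mul_card_fixed Nat.prime_three (by decide) hcard htor φ
    frobenius_eq_of_three_torsion (n := n) (map_frobenius_iterate (by rw [hL, hF]) _)
  have hle : Nat.card {P // φ P = P} ≤ 2 * 3 ^ m + 1 := hF ▸ card_fixed_le ha
  obtain ⟨j, -, hj⟩ : ∃ j ≤ m * n, Nat.card {P // φ P = P} = 3 ^ j := by
    rw [← Nat.dvd_prime_pow Nat.prime_three, ← hcard]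
    exact AddSubgroup.card_addSubgroup_dvd_card (φ.eqLocus (AddMonoidHom.id _))
  rw [hj] at hle hdvd
  -- A power of `3` that is at most `2 * 3 ^ m + 1` is at most `3 ^ m`.
  have hjm : j ≤ m := by
    by_contra! h
    have h1 : 3 ^ (m + 1) ≤ 3 ^ j := Nat.pow_le_pow_right (by norm_num) h
    have h2 : 3 ^ 1 ≤ 3 ^ m := Nat.pow_le_pow_right (by norm_num) (Nat.pos_of_ne_zero hm)
    rw [pow_succ] at h1
    omega
  have h1 : 3 ^ (m * n) ≤ n * 3 ^ m :=
    (Nat.le_of_dvd (by positivity) hdvd).trans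
      (Nat.mul_le_mul_left _ (Nat.pow_le_pow_right (by norm_num) hjm))
  obtain ⟨k, rfl⟩ : ∃ k, n = k + 1 := ⟨n - 1, by omega⟩
  rw [mul_add, mul_one, pow_add] at h1
  have h2 : 3 ^ (m * k) ≤ k + 1 := Nat.le_of_mul_le_mul_right h1 (by positivity)
  have h3 : 3 ^ k ≤ 3 ^ (m * k) :=
    Nat.pow_le_pow_right (by norm_num) (Nat.le_mul_of_pos_left k (Nat.pos_of_ne_zero hm))
  have h4 := one_add_mul_le_pow (a := (2 : ℤ)) (by norm_num) k
  have h5 : (3 : ℤ) ^ k ≤ k + 1 := by exact_mod_cast h3.trans h2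
  norm_num at h4
  omega

end Frobenius

/-! ### Kloosterman sums count points -/

section KloostermanSums

variable {F L : Type*} [Field F] [Algebra (ZMod 3) F] [Field L] [Algebra F L] [Fintype L]

theorem exists_addChar_eq_eExt [Finite F] {ω : ℂ} (hω : IsPrimitiveRoot ω 3) :
    ∃ ψ : AddChar L ℂ, (∀ y, ψ y = eExt F L ω y) ∧ ψ ≠ 1 ∧ ∀ y, ψ (y ^ 3) = ψ y := by
  have : Fact (Nat.Prime 3) := ⟨Nat.prime_three⟩
  let _ : Algebra (ZMod 3) L := ((algebraMap F L).comp (algebraMap (ZMod 3) F)).toAlgebra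
  have : IsScalarTower (ZMod 3) F L := .of_algebraMap_eq fun _ => rfl
  have htr : ∀ y : L, Algebra.trace (ZMod 3) F (Algebra.trace F L y) = Algebra.trace (ZMod 3) L y :=
    fun y => Algebra.trace_trace y
  let ψ : AddChar L ℂ :=
    (AddChar.zmodChar 3 hω.pow_eq_one).compAddMonoidHom
      (Algebra.trace (ZMod 3) L).toAddMonoidHom
  have hψ : ∀ y, ψ y = ω ^ (Algebra.trace (ZMod 3) L y).val := fun y => rfl
  refine ⟨ψ, fun y => ?_, ?_, fun y => ?_⟩
  · rw [hψ, eExt, e, htr]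
  · obtain ⟨b, hb⟩ := Algebra.trace_surjective (ZMod 3) L 1
    rw [AddChar.ne_one_iff]
    refine ⟨b, ?_⟩
    rw [hψ, hb, ZMod.val_one, pow_one]
    exact hω.ne_one (by norm_num)
  · rw [hψ, hψ]
    congr 2
    have := Algebra.trace_eq_of_algEquiv (FiniteField.frobeniusAlgEquivOfAlgebraic (ZMod 3) L) y
    simpa using this

/-- The number of points over `L` of the curve `y ^ 2 = x ^ 3 + x ^ 2 - a`, point at infinity
included, is `|L| + K_n(a)`. -/
theorem card_ternaryCurve_point_eq [Finite F] [CharP L 3] {ω : ℂ} (hω : IsPrimitiveRoot ω 3)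
    {a : F} (ha : a ≠ 0) :
    (Nat.card (ternaryCurve (algebraMap F L a)).Point : ℂ) =
      Fintype.card L + kloostermanExt F L ω a := by
  classical
  have ha' : algebraMap F L a ≠ 0 := by simpa using ha
  obtain ⟨ψ, hψ, hψ1, hfrob⟩ := exists_addChar_eq_eExt (F := F) (L := L) hω
  have h := card_ternaryCurve_point ha'
  rw [← Int.cast_inj (α := ℂ)] at h
  push_cast at h
  rw [h, kloostermanExt]
  simp only [← hψ]
  rw [sum_addChar_add_div_eq_sum_quadraticChar hψ1 hfrob ha']
  ring

end KloostermanSums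

end TernaryKloosterman

theorem corollary2 (m n : ℕ) (hn : 2 ≤ n)
    (F : Type*) [Field F] [Fintype F] [Algebra (ZMod 3) F] (hF : Fintype.card F = 3 ^ m)
    (L : Type*) [Field L] [Fintype L] [Algebra F L] (hL : Fintype.card L = (3 ^ m) ^ n)
    (ω : ℂ) (hω : IsPrimitiveRoot ω 3) (a : F) (ha : a ≠ 0) :
    TernaryKloosterman.kloostermanExt F L ω a ≠ 0 := by
  intro hK
  have : CharP F 3 := charP_of_injective_algebraMap' (ZMod 3) 3
  have : CharP L 3 := charP_of_injective_algebraMap' F 3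
  have h := TernaryKloosterman.card_ternaryCurve_point_eq (L := L) hω ha
  rw [hK, add_zero] at h
  exact TernaryKloosterman.card_ternaryCurve_point_ne hn hF hL ha (by exact_mod_cast h)
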